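/- Let $K>1$, let $\mu=\mu_1\times\dots\times\mu_K$ be a product of probability distributions $\mu_k$ on measurable spaces $S_k$, put $S=S_1\times\dots\times S_K$ (with the product $\sigma$-algebra), and let $\gamma$ be a finite (unsigned) measure on $S$ that is absolutely continuous with respect to $\mu$, with density $w=d\gamma/d\mu$. Let $X^1,X^2,\dots$ be i.i.d. samples from $\mu$, $X^n=(X^n_1,\dots,X^n_K)$. For $f:S\to\mathbb R$ and $N>0$ put $$\mu^N(f)=\frac1N\sum_{n=1}^N f(X^n),\qquad \mu^N_\times(f)=\frac1{N^K}\sum_{(n_1,\dots,n_K)\in\{1,\dots,N\}^K} f(X^{n_1}_1,\dots,X^{n_K}_K),$$ and let $\gamma^N(\varphi)=\mu^N(w\varphi)$ and $\gamma^N_\times(\varphi)=\mu^N_\times(w\varphi)$ be the standard and the product-form importance sampling estimators of $\gamma(\varphi)=\int\varphi\,d\gamma$. For $A\subseteq[K]=\{1,\dots,K\}$ write $\mu_A=\prod_{k\in A}\mu_k$, let $\mu_A(f)$ be the function of the remaining coordinates obtained by integrating the coordinates in $A$ of the argument of $f$ against $\mu_A$, and $A^c=[K]\setminus A$. Put $$\sigma^2(f)=\mu([f-\mu(f)]^2),\qquad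 \sigma^2_\times(f)=\sum_{k=1}^K\mu_k\big([\mu_{\{k\}^c}(f)-\mu(f)]^2\big),\qquad \sigma^2_{A,B}(\psi)=\mu_B\big([\mu_{A\setminus B}(\psi)-\mu_A(\psi)]^2\big)\quad (B\subseteq A).$$ If $\varphi$ is $\gamma$-integrable, then $\gamma^N_\times(\varphi)$ is an unbiased estimator of $\gamma(\varphi)$: it is integrable and $\mathbb E[\gamma^N_\times(\varphi)]=\gamma(\varphi)$ for all $N>0$. If, furthermore, $w\varphi\in L^2_\mu$, then the estimators are square integrable, $\mu_{A^c}(w\varphi)\in L^2_{\mu_A}$ for all $A\subseteq[K]$, and: 1. $\gamma^N_\times(\varphi)$ is strongly consistent: $\gamma^N_\times(\varphi)\to\gamma(\varphi)$ almost surely as $N\to\infty$. 2. $\gamma^N_\times(\varphi)$ and $\gamma^N(\varphi)$ are asymptotically normal, with asymptotic variances $\sigma^2_\times(w\varphi)$ and $\sigma^2(w\varphi)$ respectively: as $N\to\infty$, $N^{1/2}[\gamma^N_\times(\varphi)-\gamma(\varphi)]\Rightarrow\mathcal N(0,\sigma^2_\times(w\varphi))$ and $N^{1/2}[\gamma^N(\varphi)-\gamma(\varphi)]\Rightarrow\mathcal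 N(0,\sigma^2(w\varphi))$. 3. For all $N>0$, $$\mathrm{Var}(\gamma^N_\times(\varphi))=\sum_{\emptyset\ne A\subseteq[K]}\frac1{N^{|A|}}\sum_{B\subseteq A}(-1)^{|A|-|B|}\sigma^2_{A,B}(\mu_{A^c}(w\varphi))\le\mathrm{Var}(\gamma^N(\varphi)).$$ 4. $\sigma^2_\times(w\varphi)\le\sigma^2(w\varphi)$. -/

import Mathlib

open MeasureTheory ProbabilityTheory Filter Topology

noncomputable section

/-- The standard Monte Carlo estimator `μ^N(f) = N⁻¹ ∑ₙ f(xⁿ)` built from the first `N` terms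
of a sequence of points of `S₁ × ⋯ × S_K`. -/
def standardEstimator {K : ℕ} {S : Fin K → Type*} (N : ℕ) (f : (∀ k, S k) → ℝ)
    (x : ℕ → ∀ k, S k) : ℝ :=
  (1 / (N : ℝ)) * ∑ n : Fin N, f (x n)

/-- The product-form estimator `μ^N_×(f) = N^{-K} ∑_{(n₁,…,n_K) ∈ [N]^K} f(x₁^{n₁}, …, x_K^{n_K})`
built from the first `N` terms of a sequence of points of `S₁ × ⋯ × S_K`. -/
def productEstimator {K : ℕ} {S : Fin K → Type*} (N : ℕ) (f : (∀ k, S k) → ℝ)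
    (x : ℕ → ∀ k, S k) : ℝ :=
  (1 / (N : ℝ) ^ K) * ∑ n : Fin K → Fin N, f (fun k => x (n k) k)

/-- The standard importance sampling estimator `γ^N(φ) = μ^N(wφ)`. -/
def standardIS {K : ℕ} {S : Fin K → Type*} (N : ℕ) (w φ : (∀ k, S k) → ℝ)
    (x : ℕ → ∀ k, S k) : ℝ :=
  standardEstimator N (fun y => w y * φ y) x

/-- The product-form importance sampling estimator `γ^N_×(φ) = μ^N_×(wφ)`. -/
def productIS {K : ℕ} {S : Fin K → Type*} (N : ℕ) (w φ : (∀ k, S k) → ℝ)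
    (x : ℕ → ∀ k, S k) : ℝ :=
  productEstimator N (fun y => w y * φ y) x

/-- `μ_A(f)`: the coordinates in `A` of the argument of `f` are integrated against the product
of the `μ k`, `k ∈ A`. The result is regarded as a function on the whole product which ignores
the coordinates in `A`; in particular `μ_∅(f) = f`. -/
def partialMean {K : ℕ} {S : Fin K → Type*} [∀ k, MeasurableSpace (S k)]
    (μ : ∀ k, Measure (S k)) (A : Finset (Fin K)) (f : (∀ k, S k) → ℝ) : (∀ k, S k) → ℝ :=
  fun x => ∫ y : (∀ k : A, S k), f (Function.updateFinset x A y) ∂Measure.pi fun k : A => μ k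

/-- `σ²_{A,B}(ψ) = μ_B([μ_{A∖B}(ψ) - μ_A(ψ)]²)` for `B ⊆ A` and a function `ψ` of the coordinates
in `A`. The integrand depends only on the coordinates in `B`, so (the `μ k` being probability
measures) its integral against `μ_B` is its integral against the full product. -/
def sigmaSqAB {K : ℕ} {S : Fin K → Type*} [∀ k, MeasurableSpace (S k)]
    (μ : ∀ k, Measure (S k)) (A B : Finset (Fin K)) (ψ : (∀ k, S k) → ℝ) : ℝ :=
  ∫ x, (partialMean μ (A \ B) ψ x - partialMean μ A ψ x) ^ 2 ∂Measure.pi μ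

/-- `σ²(f) = μ([f - μ(f)]²)`, where `μ` is the full product. -/
def sigmaSq {K : ℕ} {S : Fin K → Type*} [∀ k, MeasurableSpace (S k)]
    (μ : ∀ k, Measure (S k)) (f : (∀ k, S k) → ℝ) : ℝ :=
  ∫ x, (f x - ∫ z, f z ∂Measure.pi μ) ^ 2 ∂Measure.pi μ

/-- `σ²_×(f) = ∑ₖ μ_k([μ_{{k}ᶜ}(f) - μ(f)]²)`. Each integrand depends only on the `k`-th
coordinate, so its integral against `μ k` is its integral against the full product. -/
def sigmaSqProd {K : ℕ} {S : Fin K → Type*} [∀ k, MeasurableSpace (S k)]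
    (μ : ∀ k, Measure (S k)) (f : (∀ k, S k) → ℝ) : ℝ :=
  ∑ k : Fin K, ∫ x, (partialMean μ {k}ᶜ f x - ∫ z, f z ∂Measure.pi μ) ^ 2 ∂Measure.pi μ

/-- `∑_{∅ ≠ A ⊆ [K]} N^{-|A|} ∑_{B ⊆ A} (-1)^{|A|-|B|} σ²_{A,B}(μ_{Aᶜ}(f))`, the explicit
expression for the variance of the product-form estimator. -/
def productVarianceFormula {K : ℕ} {S : Fin K → Type*} [∀ k, MeasurableSpace (S k)]
    (μ : ∀ k, Measure (S k)) (N : ℕ) (f : (∀ k, S k) → ℝ) : ℝ :=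
  ∑ A : Finset (Fin K) with A.Nonempty, (1 / (N : ℝ) ^ A.card) *
    ∑ B ∈ A.powerset, (-1 : ℝ) ^ (A.card - B.card) * sigmaSqAB μ A B (partialMean μ Aᶜ f)

/-- The sequence of real random variables `T 0, T 1, …` is asymptotically normal around `m` with
asymptotic variance `v`: `√N (T N - m)` converges in distribution to `𝒩(0, v)`. -/
def AsymptoticallyNormal {Ω : Type*} [MeasurableSpace Ω] (P : Measure Ω) [IsProbabilityMeasure P]
    (T : ℕ → Ω → ℝ) (m v : ℝ) : Prop :=
  0 ≤ v ∧ TendstoInDistribution (fun (N : ℕ) ω => √(N : ℝ) * (T N ω - m)) atTop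
    (id : ℝ → ℝ) (fun _ => P) (gaussianReal 0 v.toNNReal)

end

/-! ### Partial means as orthogonal projections in L². -/

section PartialMean

variable {K : ℕ} {S : Fin K → Type*} [∀ k, MeasurableSpace (S k)]
  (μ : ∀ k, Measure (S k)) [∀ k, IsProbabilityMeasure (μ k)]

/-! Write `f = wφ` and `μ` for the product measure. By Radon–Nikodym `γ(φ) = μ(f)`, so everything
concerns the two estimators of `μ(f)`. All coordinates of all samples are independent, so each
recombined point has law `μ`; this gives unbiasedness.

Variance. If two multi-indices agree exactly on `B`, the product of the corresponding values of `f`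
has expectation `projSq μ f B`, the squared L² norm of `μ_{Bᶜ}(f)`
(`integral_recombine_mul_recombine`). Counting pairs by their agreement set (`sum_sum_agree`) gives
the second moment, and expanding `(1 - 1/N)^|Bᶜ|` (`sum_pow_card_mul_one_sub_pow`) gives the formula
over `A`. For the comparison, the product-form estimator is an average of standard estimators built
from cyclically shifted coordinates (`productEstimator_eq_average_shift`), and squaring is convex.

Limits. For centred `f`, subtract the main effects, the sum of the one-coordinate projections. On
them the two estimators coincide, so the classical strong law and central limit theorem apply. The
residual has zero `projSq` for `|B| < 2`, so its estimator has second moment `O(N⁻²)`: summable, and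
negligible after scaling by `√N`. The main effects have variance `σ²_×`, and Bessel's inequality
gives `σ²_× ≤ σ²`. -/

omit [∀ k, MeasurableSpace (S k)] in
lemma piecewise_eq_updateFinset (A : Finset (Fin K)) (x y : ∀ k, S k) :
    A.piecewise y x = Function.updateFinset x A (A.restrict y) := by
  ext k
  by_cases hk : k ∈ A <;> simp [Function.updateFinset, hk]

lemma integral_pi_comp_restrict (A : Finset (Fin K)) (g : (∀ k : A, S k) → ℝ) :
    ∫ y, g (A.restrict y) ∂Measure.pi μ = ∫ y, g y ∂Measure.pi fun k : A => μ k := by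
  have h := measurePreserving_piEquivPiSubtypeProd μ (· ∈ A)
  have := h.integral_comp (MeasurableEquiv.measurableEmbedding _) (fun z => g z.1)
  rw [integral_fun_fst] at this
  rw [probReal_univ, one_smul] at this
  convert! this

/-- `μ_A(f)` written as an integral over the full product. -/
lemma partialMean_apply (A : Finset (Fin K)) (f : (∀ k, S k) → ℝ) (x : ∀ k, S k) :
    partialMean μ A f x = ∫ y, f (A.piecewise y x) ∂Measure.pi μ := by
  simp_rw [piecewise_eq_updateFinset]
  rw [integral_pi_comp_restrict μ A (fun y => f (Function.updateFinset x A y))]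
  rfl

lemma partialMean_univ (f : (∀ k, S k) → ℝ) (x : ∀ k, S k) :
    partialMean μ Finset.univ f x = ∫ y, f y ∂Measure.pi μ := by
  simp [partialMean_apply]

lemma partialMean_congr_point (A : Finset (Fin K)) (f : (∀ k, S k) → ℝ) {x x' : ∀ k, S k}
    (h : ∀ k ∉ A, x k = x' k) : partialMean μ A f x = partialMean μ A f x' := by
  rw [partialMean_apply, partialMean_apply]
  refine integral_congr_ae (ae_of_all _ fun y => congrArg f (funext fun k => ?_))
  by_cases hk : k ∈ A <;> simp [hk, h]

/-- Resampling the coordinates in `A` from an independent copy leaves the law unchanged: the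
preimage of a box is a product of two boxes. Through this map, Fubini on the pair yields all the
facts about partial means below. -/
lemma measurePreserving_piecewise (A : Finset (Fin K)) :
    MeasurePreserving (fun p : (∀ k, S k) × (∀ k, S k) => A.piecewise p.2 p.1)
      ((Measure.pi μ).prod (Measure.pi μ)) (Measure.pi μ) := by
  have hm : Measurable (fun p : (∀ k, S k) × (∀ k, S k) => A.piecewise p.2 p.1) := by
    refine measurable_pi_lambda _ fun k => ?_
    by_cases hk : k ∈ A <;> simp only [hk, Finset.piecewise_eq_of_mem, Finset.piecewise_eq_of_notMem,
      not_false_eq_true] <;> fun_prop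
  refine ⟨hm, (Measure.pi_eq fun s hs => ?_).symm⟩
  rw [Measure.map_apply hm (MeasurableSet.univ_pi hs)]
  have : (fun p : (∀ k, S k) × (∀ k, S k) => A.piecewise p.2 p.1) ⁻¹' Set.univ.pi s
      = (Set.univ.pi fun k => if k ∈ A then Set.univ else s k) ×ˢ
        (Set.univ.pi fun k => if k ∈ A then s k else Set.univ) := by
    ext p
    simp only [Set.mem_preimage, Set.mem_univ_pi, Set.mem_prod, ← forall_and]
    refine forall_congr' fun k => ?_
    by_cases hk : k ∈ A <;> simp [hk]
  rw [this, Measure.prod_prod, Measure.pi_pi, Measure.pi_pi, ← Finset.prod_mul_distrib]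
  refine Finset.prod_congr rfl fun k _ => ?_
  by_cases hk : k ∈ A <;> simp [hk]

variable {μ}

lemma MeasureTheory.Integrable.ae_integrable_piecewise {f : (∀ k, S k) → ℝ}
    (hf : Integrable f (Measure.pi μ)) (A : Finset (Fin K)) :
    ∀ᵐ x ∂Measure.pi μ, Integrable (fun y => f (A.piecewise y x)) (Measure.pi μ) :=
  ((measurePreserving_piecewise μ A).integrable_comp_of_integrable hf).prod_right_ae

lemma integrable_partialMean {f : (∀ k, S k) → ℝ}
    (hf : Integrable f (Measure.pi μ)) (A : Finset (Fin K)) :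
    Integrable (partialMean μ A f) (Measure.pi μ) := by
  have := ((measurePreserving_piecewise μ A).integrable_comp_of_integrable hf).integral_prod_left
  refine this.congr (ae_of_all _ fun x => ?_)
  simp [partialMean_apply]

lemma integral_integral_piecewise {f : (∀ k, S k) → ℝ}
    (hf : Integrable f (Measure.pi μ)) (A : Finset (Fin K)) :
    ∫ x, ∫ y, f (A.piecewise y x) ∂Measure.pi μ ∂Measure.pi μ = ∫ x, f x ∂Measure.pi μ := by
  have hp := measurePreserving_piecewise μ A
  have h := integral_map (f := f) hp.aemeasurable (by rw [hp.map_eq]; exact hf.1)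
  rw [hp.map_eq] at h
  rw [h]
  exact (integral_prod _ (hp.integrable_comp_of_integrable hf)).symm

lemma integral_partialMean {f : (∀ k, S k) → ℝ}
    (hf : Integrable f (Measure.pi μ)) (A : Finset (Fin K)) :
    ∫ x, partialMean μ A f x ∂Measure.pi μ = ∫ x, f x ∂Measure.pi μ := by
  simp_rw [partialMean_apply, integral_integral_piecewise hf]

lemma partialMean_sub {f g : (∀ k, S k) → ℝ} (hf : Integrable f (Measure.pi μ))
    (hg : Integrable g (Measure.pi μ)) (A : Finset (Fin K)) :
    partialMean μ A (fun x => f x - g x) =ᵐ[Measure.pi μ]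
      fun x => partialMean μ A f x - partialMean μ A g x := by
  filter_upwards [hf.ae_integrable_piecewise A, hg.ae_integrable_piecewise A] with x hfx hgx
  simp only [partialMean_apply]
  exact integral_sub hfx hgx

lemma partialMean_const (c : ℝ) (A : Finset (Fin K)) (x : ∀ k, S k) :
    partialMean μ A (fun _ => c) x = c := by
  simp [partialMean_apply]

lemma partialMean_sum {ι : Type*} (s : Finset ι) {f : ι → (∀ k, S k) → ℝ}
    (hf : ∀ i, Integrable (f i) (Measure.pi μ)) (A : Finset (Fin K)) :
    partialMean μ A (fun x => ∑ i ∈ s, f i x) =ᵐ[Measure.pi μ]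
      fun x => ∑ i ∈ s, partialMean μ A (f i) x := by
  have : ∀ᵐ x ∂Measure.pi μ, ∀ i ∈ s, Integrable (fun y => f i (A.piecewise y x))
      (Measure.pi μ) :=
    (ae_ball_iff s.countable_toSet).2 fun i _ => (hf i).ae_integrable_piecewise A
  filter_upwards [this] with x hx
  simp only [partialMean_apply]
  exact integral_finsetSum _ hx

/-- Fubini on the slice through `x` in the directions `A ∪ B`. The equality is only almost
everywhere because that slice must be integrable. -/
lemma partialMean_partialMean {f : (∀ k, S k) → ℝ} (hf : Integrable f (Measure.pi μ))
    (A B : Finset (Fin K)) :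
    partialMean μ A (partialMean μ B f) =ᵐ[Measure.pi μ] partialMean μ (A ∪ B) f := by
  filter_upwards [hf.ae_integrable_piecewise (A ∪ B)] with x hx
  simp only [partialMean_apply]
  rw [← integral_integral_piecewise hx B]
  refine integral_congr_ae (ae_of_all _ fun y => integral_congr_ae (ae_of_all _ fun z =>
    congrArg f (funext fun k => ?_)))
  by_cases hA : k ∈ A <;> by_cases hB : k ∈ B <;> simp [hA, hB]

/-- Jensen on each slice: nonnegativity of the slice variance bounds the square of the partial mean
by the partial mean of the square. -/
lemma memLp_two_partialMean {f : (∀ k, S k) → ℝ} (hf : MemLp f 2 (Measure.pi μ))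
    (A : Finset (Fin K)) : MemLp (partialMean μ A f) 2 (Measure.pi μ) := by
  have hi := hf.integrable one_le_two
  have hsq := hf.integrable_sq
  have hI := integrable_partialMean hi A
  refine (memLp_two_iff_integrable_sq hI.1).2 ?_
  refine (integrable_partialMean hsq A).mono (hI.1.pow 2) ?_
  have hfm := ((measurePreserving_piecewise μ A).integrable_comp_of_integrable hi).1.prodMk_left
  filter_upwards [hsq.ae_integrable_piecewise A, hfm] with x hx hm
  have h2 : MemLp (fun y => f (A.piecewise y x)) 2 (Measure.pi μ) :=
    (memLp_two_iff_integrable_sq hm).2 hx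
  have := variance_nonneg (fun y => f (A.piecewise y x)) (Measure.pi μ)
  rw [variance_eq_sub h2] at this
  rw [partialMean_apply, partialMean_apply, Real.norm_of_nonneg (sq_nonneg _)]
  exact (by simpa using this : _ ≤ _).trans (le_abs_self _)

/-- Integrate out the coordinates in `A` first; the factor `μ_A(v)` ignores them and comes out of
the integral. -/
lemma integral_mul_partialMean {u v : (∀ k, S k) → ℝ} (hu : MemLp u 2 (Measure.pi μ))
    (hv : MemLp v 2 (Measure.pi μ)) (A : Finset (Fin K)) :
    ∫ x, u x * partialMean μ A v x ∂Measure.pi μ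
      = ∫ x, partialMean μ A u x * partialMean μ A v x ∂Measure.pi μ := by
  have hi : Integrable (fun x => u x * partialMean μ A v x) (Measure.pi μ) :=
    hu.integrable_mul (memLp_two_partialMean hv A)
  rw [← integral_partialMean hi A]
  congr! 2 with x
  rw [partialMean_apply]
  have : ∀ y, partialMean μ A v (A.piecewise y x) = partialMean μ A v x := fun y =>
    partialMean_congr_point μ A v fun k hk => by simp [hk]
  simp_rw [this, integral_mul_const, partialMean_apply]

end PartialMean

/-! ### Independence and laws of recombined samples. -/

section Samples

variable {K : ℕ} {S : Fin K → Type*} [∀ k, MeasurableSpace (S k)]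
  {μ : ∀ k, Measure (S k)} [∀ k, IsProbabilityMeasure (μ k)]
  {Ω : Type*} [MeasurableSpace Ω] {P : Measure Ω} [IsProbabilityMeasure P]
  {X : ℕ → Ω → ∀ k, S k}

/-- Samples are independent of each other, and the coordinates within one are independent because
its law is a product. -/
lemma iIndepFun_coordinates (hX : ∀ n, HasLaw (X n) (Measure.pi μ) P) (hind : iIndepFun X P)
    (hm : ∀ n, Measurable (X n)) :
    iIndepFun (fun (p : (_ : ℕ) × Fin K) ω => X p.1 ω p.2) P := by
  refine iIndepFun_uncurry (X := fun n k ω => X n ω k)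
    (fun n k => (measurable_pi_apply k).comp (hm n)) hind fun n => ?_
  exact (iIndepFun_iff_hasLaw_pi_pi (X := fun k ω => X n ω k)
    fun k => (measurePreserving_eval μ k).comp_hasLaw (hX n)).2 (hX n)

lemma hasLaw_recombine_of_measurable (hX : ∀ n, HasLaw (X n) (Measure.pi μ) P)
    (hind : iIndepFun X P) (hm : ∀ n, Measurable (X n)) (n : Fin K → ℕ) :
    HasLaw (fun ω k => X (n k) ω k) (Measure.pi μ) P := by
  have hinj : Function.Injective fun k => (⟨n k, k⟩ : (_ : ℕ) × Fin K) := fun k l h => by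
    simpa using congrArg Sigma.snd h
  exact ((iIndepFun_coordinates hX hind hm).precomp hinj).hasLaw_pi
    fun k => (measurePreserving_eval μ k).comp_hasLaw (hX (n k))

lemma indepFun_recombine_of_measurable (hX : ∀ n, HasLaw (X n) (Measure.pi μ) P)
    (hind : iIndepFun X P) (hm : ∀ n, Measurable (X n)) {n n' : Fin K → ℕ}
    (hn : ∀ k, n k ≠ n' k) :
    IndepFun (fun ω k => X (n k) ω k) (fun ω k => X (n' k) ω k) P := by
  let I (n : Fin K → ℕ) : Finset ((_ : ℕ) × Fin K) := Finset.univ.image fun k => ⟨n k, k⟩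
  have hI (n : Fin K → ℕ) (k : Fin K) : ⟨n k, k⟩ ∈ I n :=
    Finset.mem_image_of_mem _ (Finset.mem_univ k)
  have hd : Disjoint (I n) (I n') := by
    simp only [I, Finset.disjoint_left, Finset.mem_image, Finset.mem_univ, true_and]
    rintro _ ⟨k, rfl⟩ ⟨l, h⟩
    obtain rfl : l = k := by simpa using congrArg Sigma.snd h
    exact hn l (congrArg Sigma.fst h).symm
  have := (iIndepFun_coordinates hX hind hm).indepFun_finset (I n) (I n') hd
    fun p => (measurable_pi_apply p.2).comp (hm p.1)
  exact this.comp (φ := fun u k => u ⟨⟨n k, k⟩, hI n k⟩) (ψ := fun u k => u ⟨⟨n' k, k⟩, hI n' k⟩)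
    (measurable_pi_lambda _ fun k => measurable_pi_apply _)
    (measurable_pi_lambda _ fun k => measurable_pi_apply _)

omit [∀ k, IsProbabilityMeasure (μ k)] [IsProbabilityMeasure P] in
/-- An almost everywhere measurable i.i.d. sequence has a measurable i.i.d. modification. -/
lemma exists_measurable_modification (hX : ∀ n, HasLaw (X n) (Measure.pi μ) P)
    (hind : iIndepFun X P) :
    ∃ X' : ℕ → Ω → ∀ k, S k, (∀ n, HasLaw (X' n) (Measure.pi μ) P) ∧ iIndepFun X' P ∧
      (∀ n, Measurable (X' n)) ∧ ∀ n, X' n =ᵐ[P] X n :=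
  have h n := (hX n).aemeasurable.ae_eq_mk
  ⟨fun n => (hX n).aemeasurable.mk, fun n => (hX n).congr (h n).symm,
    hind.congr h, fun n => (hX n).aemeasurable.measurable_mk, fun n => (h n).symm⟩

omit [∀ k, MeasurableSpace (S k)] [IsProbabilityMeasure P] in
lemma recombine_ae_eq {X' : ℕ → Ω → ∀ k, S k} (h : ∀ n, X' n =ᵐ[P] X n) (n : Fin K → ℕ) :
    (fun ω k => X' (n k) ω k) =ᵐ[P] fun ω k => X (n k) ω k := by
  filter_upwards [ae_all_iff.2 h] with ω hω
  simp [hω]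

lemma hasLaw_recombine (hX : ∀ n, HasLaw (X n) (Measure.pi μ) P) (hind : iIndepFun X P)
    (n : Fin K → ℕ) : HasLaw (fun ω k => X (n k) ω k) (Measure.pi μ) P := by
  obtain ⟨X', hX', hind', hm, h⟩ := exists_measurable_modification hX hind
  exact (hasLaw_recombine_of_measurable hX' hind' hm n).congr (recombine_ae_eq h n).symm

lemma indepFun_recombine (hX : ∀ n, HasLaw (X n) (Measure.pi μ) P) (hind : iIndepFun X P)
    {n n' : Fin K → ℕ} (hn : ∀ k, n k ≠ n' k) :
    IndepFun (fun ω k => X (n k) ω k) (fun ω k => X (n' k) ω k) P := by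
  obtain ⟨X', hX', hind', hm, h⟩ := exists_measurable_modification hX hind
  exact (indepFun_recombine_of_measurable hX' hind' hm hn).congr (recombine_ae_eq h n)
    (recombine_ae_eq h n')

/-- `π([π_{Bᶜ}(f)]²)`, the second moment of the projection of `f` onto the coordinates in `B`. -/
noncomputable def projSq (μ : ∀ k, Measure (S k)) (f : (∀ k, S k) → ℝ) (B : Finset (Fin K)) : ℝ :=
  ∫ x, partialMean μ Bᶜ f x ^ 2 ∂Measure.pi μ

lemma integral_recombine_mul_recombine (hX : ∀ n, HasLaw (X n) (Measure.pi μ) P)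
    (hind : iIndepFun X P) {f : (∀ k, S k) → ℝ} (hf : MemLp f 2 (Measure.pi μ))
    (n n' : Fin K → ℕ) :
    ∫ ω, f (fun k => X (n k) ω k) * f (fun k => X (n' k) ω k) ∂P
      = projSq μ f {k | n k = n' k} := by
  set B : Finset (Fin K) := {k | n k = n' k} with hB
  -- On the agreement set, `n'` is replaced by `n k + 1`, chosen only to differ from `n k`. The new
  -- point is then independent of the first, and the original second point takes its `B` coordinates
  -- from the first and the others from the new one.
  have hlaw := (indepFun_iff_hasLaw_prodMk_prod
    (hasLaw_recombine hX hind n) (hasLaw_recombine hX hind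
      (fun k => if k ∈ B then n k + 1 else n' k))).1
    (indepFun_recombine hX hind fun k => by by_cases hk : n k = n' k <;> simp [hB, hk])
  have hmp := measurePreserving_piecewise μ Bᶜ
  have hint : Integrable (fun p : (∀ k, S k) × (∀ k, S k) => f p.1 * f (Bᶜ.piecewise p.2 p.1))
      ((Measure.pi μ).prod (Measure.pi μ)) :=
    (hf.comp_measurePreserving measurePreserving_fst).integrable_mul
      (hf.comp_measurePreserving hmp)
  have h1 := hlaw.integral_comp hint.1
  rw [integral_prod _ hint] at h1
  simp_rw [integral_const_mul, ← partialMean_apply] at h1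
  rw [integral_mul_partialMean hf hf] at h1
  simp_rw [projSq, sq, ← h1]
  refine integral_congr_ae (ae_of_all _ fun ω => ?_)
  refine congrArg (f (fun k => X (n k) ω k) * f ·) (funext fun k => ?_)
  by_cases hk : n k = n' k <;> simp [hB, hk]

end Samples

/-! ### Counting agreement sets and Möbius inversion. -/

section Combinatorics

lemma Fintype.sum_sum_prod_eq_prod_sum_sum {κ ι : Type*} [Fintype κ] [DecidableEq κ] [Fintype ι]
    (g : κ → ι → ι → ℝ) :
    ∑ n : κ → ι, ∑ n' : κ → ι, ∏ k, g k (n k) (n' k) = ∏ k, ∑ a, ∑ b, g k a b := by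
  simp_rw [Finset.prod_univ_sum, Fintype.piFinset_univ]

lemma Fin.sum_sum_ite_eq (N : ℕ) :
    ∑ a : Fin N, ∑ b : Fin N, (if a = b then (1 : ℝ) else 0) = N := by
  simp

lemma Fin.sum_sum_ite_ne (N : ℕ) :
    ∑ a : Fin N, ∑ b : Fin N, (if a = b then (0 : ℝ) else 1) = N ^ 2 - N := by
  have h (a b : Fin N) : (if a = b then (0 : ℝ) else 1) = 1 - if a = b then 1 else 0 := by
    split_ifs <;> simp
  simp_rw [h, Finset.sum_sub_distrib, Fin.sum_sum_ite_eq]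
  simp [sq]

/-- Pairs of multi-indices, counted according to the set of coordinates on which they agree. -/
lemma sum_sum_agree {K : ℕ} (N : ℕ) (G : Finset (Fin K) → ℝ) :
    ∑ n : Fin K → Fin N, ∑ n' : Fin K → Fin N, G {k | n k = n' k}
      = ∑ B, (N : ℝ) ^ B.card * ((N : ℝ) ^ 2 - N) ^ Bᶜ.card * G B := by
  -- The indicator that the agreement set equals `B` is a product over coordinates, so the double
  -- sum factorizes.
  have h (n n' : Fin K → Fin N) : G {k | n k = n' k}
      = ∑ B, (∏ k, if k ∈ B then (if n k = n' k then (1 : ℝ) else 0)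
          else if n k = n' k then 0 else 1) * G B := by
    rw [Finset.sum_eq_single ({k | n k = n' k} : Finset (Fin K))]
    · rw [Finset.prod_eq_one, one_mul]
      intro k _
      by_cases hk : n k = n' k <;> simp [hk]
    · intro B _ hB
      obtain ⟨k, hk⟩ : ∃ k, ¬ (k ∈ B ↔ n k = n' k) := by
        by_contra! hc
        exact hB (by ext k; simp [hc k])
      rw [Finset.prod_eq_zero (Finset.mem_univ k), zero_mul]
      by_cases hkB : k ∈ B <;> by_cases hkn : n k = n' k <;> simp_all
    · simp
  simp_rw [h]
  rw [Finset.sum_congr rfl fun n _ => Finset.sum_comm]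
  rw [Finset.sum_comm]
  refine Finset.sum_congr rfl fun B _ => ?_
  simp_rw [← Finset.sum_mul]
  rw [Fintype.sum_sum_prod_eq_prod_sum_sum (fun k a b => if k ∈ B then (if a = b then (1 : ℝ) else 0)
          else if a = b then 0 else 1)]
  congr 1
  have h3 (k : Fin K) : (∑ a : Fin N, ∑ b : Fin N,
      if k ∈ B then (if a = b then (1 : ℝ) else 0) else if a = b then 0 else 1)
      = if k ∈ B then (N : ℝ) else (N : ℝ) ^ 2 - N := by
    by_cases hk : k ∈ B
    · simp only [hk, if_true, Fin.sum_sum_ite_eq]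
    · simp only [hk, if_false, Fin.sum_sum_ite_ne]
  simp_rw [h3]
  rw [Finset.prod_ite]
  simp [Finset.filter_notMem_eq_sdiff, Finset.compl_eq_univ_sdiff]

/-- Möbius inversion for the expectation over a random subset. -/
lemma sum_pow_card_mul_one_sub_pow {K : ℕ} (t : ℝ) (G : Finset (Fin K) → ℝ) :
    ∑ B, t ^ B.card * (1 - t) ^ Bᶜ.card * G B
      = ∑ A : Finset (Fin K), t ^ A.card * ∑ B ∈ A.powerset, (-1 : ℝ) ^ (A.card - B.card) * G B := by
  simp_rw [Finset.mul_sum]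
  rw [Finset.sum_comm' (t' := Finset.univ) (s' := fun B => {A | B ⊆ A}) (by simp)]
  refine Finset.sum_congr rfl fun B _ => ?_
  -- Expand `(1 - t)^|Bᶜ|` over subsets `C` of `Bᶜ` and reindex by `A = B ∪ C`.
  rw [sub_eq_neg_add, ← Finset.sum_pow_mul_eq_add_pow, Finset.mul_sum, Finset.sum_mul]
  refine Finset.sum_bij' (fun C _ => B ∪ C) (fun A _ => A \ B) ?_ ?_ ?_ ?_ ?_
  · simp
  · intro A _
    simp only [Finset.mem_powerset]
    intro k
    simp
  · intro C hC
    have : Disjoint C B := Finset.subset_compl_iff_disjoint_right.1 (Finset.mem_powerset.1 hC)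
    simp only [Finset.union_sdiff_left]
    exact this.sdiff_eq_left
  · intro A hA
    exact Finset.union_sdiff_of_subset (by simpa using hA)
  · intro C hC
    have : Disjoint C B := Finset.subset_compl_iff_disjoint_right.1 (Finset.mem_powerset.1 hC)
    rw [Finset.card_union_of_disjoint this.symm, pow_add, Nat.add_sub_cancel_left, neg_pow t]
    ring

/-- The expansion of `(1 - 1)^|A|`. It removes the squared mean by which `σ²_{A,B}` differs from
`projSq`. -/
lemma sum_powerset_neg_one_pow_card_sub {K : ℕ} {A : Finset (Fin K)} (hA : A.Nonempty) :
    ∑ B ∈ A.powerset, (-1 : ℝ) ^ (A.card - B.card) = 0 := by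
  have := Finset.sum_pow_mul_eq_add_pow (1 : ℝ) (-1) A
  simpa [hA.ne_empty] using this

end Combinatorics

/-! ### Moments and variance comparison of the two estimators. -/

section Variance

variable {K : ℕ} {S : Fin K → Type*} [∀ k, MeasurableSpace (S k)]
  {μ : ∀ k, Measure (S k)} [∀ k, IsProbabilityMeasure (μ k)]

lemma projSq_empty (f : (∀ k, S k) → ℝ) :
    projSq μ f ∅ = (∫ x, f x ∂Measure.pi μ) ^ 2 := by
  simp [projSq, partialMean_univ]

lemma projSq_univ (f : (∀ k, S k) → ℝ) :
    projSq μ f Finset.univ = ∫ x, f x ^ 2 ∂Measure.pi μ := by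
  simp [projSq, partialMean_apply]

lemma integral_sub_const_sq {g : (∀ k, S k) → ℝ} (hg : MemLp g 2 (Measure.pi μ)) {m : ℝ}
    (hm : ∫ x, g x ∂Measure.pi μ = m) :
    ∫ x, (g x - m) ^ 2 ∂Measure.pi μ = ∫ x, g x ^ 2 ∂Measure.pi μ - m ^ 2 := by
  have h := variance_eq_sub hg
  rw [variance_eq_integral hg.1.aemeasurable, hm] at h
  simpa using h

/-- Since `(A \ B) ∪ Aᶜ = Bᶜ` and `A ∪ Aᶜ` is everything, this is the variance of `μ_{Bᶜ}(f)`,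
whatever `A` is. -/
lemma sigmaSqAB_partialMean {f : (∀ k, S k) → ℝ} (hf : MemLp f 2 (Measure.pi μ))
    {A B : Finset (Fin K)} (hBA : B ⊆ A) :
    sigmaSqAB μ A B (partialMean μ Aᶜ f)
      = projSq μ f B - (∫ x, f x ∂Measure.pi μ) ^ 2 := by
  have hi := hf.integrable one_le_two
  rw [projSq, ← integral_sub_const_sq (memLp_two_partialMean hf _) (integral_partialMean hi _),
    sigmaSqAB]
  refine integral_congr_ae ?_
  filter_upwards [partialMean_partialMean hi (A \ B) Aᶜ, partialMean_partialMean hi A Aᶜ]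
    with x h1 h2
  have : A \ B ∪ Aᶜ = Bᶜ := by
    ext k
    have := @hBA k
    simp only [Finset.mem_union, Finset.mem_sdiff, Finset.mem_compl]
    tauto
  rw [h1, h2, this, Finset.union_compl, partialMean_univ]

variable {Ω : Type*} [MeasurableSpace Ω] {P : Measure Ω} [IsProbabilityMeasure P]
  {X : ℕ → Ω → ∀ k, S k}

lemma memLp_recombine (hX : ∀ n, HasLaw (X n) (Measure.pi μ) P) (hind : iIndepFun X P)
    {f : (∀ k, S k) → ℝ} {p : ENNReal} (hf : MemLp f p (Measure.pi μ)) (n : Fin K → ℕ) :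
    MemLp (fun ω => f (fun k => X (n k) ω k)) p P := by
  have h := hasLaw_recombine hX hind n
  rw [← h.map_eq] at hf
  exact hf.comp_of_map h.aemeasurable

lemma integral_recombine (hX : ∀ n, HasLaw (X n) (Measure.pi μ) P) (hind : iIndepFun X P)
    {f : (∀ k, S k) → ℝ} (hf : AEStronglyMeasurable f (Measure.pi μ)) (n : Fin K → ℕ) :
    ∫ ω, f (fun k => X (n k) ω k) ∂P = ∫ x, f x ∂Measure.pi μ :=
  (hasLaw_recombine hX hind n).integral_comp hf

lemma memLp_productEstimator (hX : ∀ n, HasLaw (X n) (Measure.pi μ) P) (hind : iIndepFun X P)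
    {f : (∀ k, S k) → ℝ} {p : ENNReal} (hf : MemLp f p (Measure.pi μ)) (N : ℕ) :
    MemLp (fun ω => productEstimator N f fun n => X n ω) p P :=
  (memLp_finsetSum Finset.univ fun (n : Fin K → Fin N) _ =>
    memLp_recombine hX hind hf fun k => (n k : ℕ)).const_mul (1 / (N : ℝ) ^ K)

lemma integral_productEstimator (hX : ∀ n, HasLaw (X n) (Measure.pi μ) P) (hind : iIndepFun X P)
    {f : (∀ k, S k) → ℝ} (hf : Integrable f (Measure.pi μ)) {N : ℕ} (hN : 0 < N) :
    ∫ ω, productEstimator N f (fun n => X n ω) ∂P = ∫ x, f x ∂Measure.pi μ := by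
  simp_rw [productEstimator]
  rw [integral_const_mul, integral_finsetSum _ fun n _ => memLp_one_iff_integrable.1
    (memLp_recombine hX hind (memLp_one_iff_integrable.2 hf) fun k => (n k : ℕ))]
  simp_rw [integral_recombine hX hind hf.1 fun k => _]
  have : (N : ℝ) ≠ 0 := by positivity
  simp [this]

/-- Two uniformly chosen multi-indices agree in each coordinate independently with probability
`1/N`; the weights are the law of their agreement set. -/
lemma integral_productEstimator_sq (hX : ∀ n, HasLaw (X n) (Measure.pi μ) P)
    (hind : iIndepFun X P) {f : (∀ k, S k) → ℝ} (hf : MemLp f 2 (Measure.pi μ)) {N : ℕ}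
    (hN : 0 < N) :
    ∫ ω, productEstimator N f (fun n => X n ω) ^ 2 ∂P
      = ∑ B, (1 / (N : ℝ)) ^ B.card * (1 - 1 / (N : ℝ)) ^ Bᶜ.card * projSq μ f B := by
  have hL (n : Fin K → Fin N) := memLp_recombine hX hind hf fun k => (n k : ℕ)
  have hI (n n' : Fin K → Fin N) :
      Integrable (fun ω => f (fun k => X (n k) ω k) * f (fun k => X (n' k) ω k)) P :=
    (hL n).integrable_mul (hL n')
  simp_rw [productEstimator, mul_pow]
  rw [integral_const_mul]
  simp_rw [sq (∑ n : Fin K → Fin N, _), Finset.sum_mul_sum]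
  rw [integral_finsetSum _ fun n _ => integrable_finsetSum _ fun n' _ => hI n n']
  have h (n : Fin K → Fin N) := integral_finsetSum (Finset.univ) fun n' _ => hI n n'
  simp_rw [h, integral_recombine_mul_recombine hX hind hf, Fin.val_inj]
  rw [sum_sum_agree N (projSq μ f), Finset.mul_sum]
  refine Finset.sum_congr rfl fun B _ => ?_
  have hN' : (N : ℝ) ≠ 0 := by positivity
  have hK : (N : ℝ) ^ K = (N : ℝ) ^ B.card * (N : ℝ) ^ Bᶜ.card := by
    rw [← pow_add, Finset.card_add_card_compl, Fintype.card_fin]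
  have h1 : 1 - 1 / (N : ℝ) = (N ^ 2 - N) / N ^ 2 := by field_simp
  rw [hK, h1]
  simp only [div_pow, one_pow, pow_right_comm _ 2]
  generalize ((N : ℝ) ^ 2 - N) ^ Bᶜ.card = q
  field_simp

lemma variance_productEstimator (hX : ∀ n, HasLaw (X n) (Measure.pi μ) P)
    (hind : iIndepFun X P) {f : (∀ k, S k) → ℝ} (hf : MemLp f 2 (Measure.pi μ)) {N : ℕ}
    (hN : 0 < N) :
    Var[fun ω => productEstimator N f (fun n => X n ω); P] = productVarianceFormula μ N f := by
  have h := variance_eq_sub (memLp_productEstimator hX hind hf N)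
  simp only [Pi.pow_apply] at h
  rw [h, integral_productEstimator hX hind (hf.integrable one_le_two) hN,
    integral_productEstimator_sq hX hind hf hN, sum_pow_card_mul_one_sub_pow,
    productVarianceFormula, ← Finset.sum_filter_add_sum_filter_not _ Finset.Nonempty]
  -- The term `A = ∅` is the squared mean, cancelled by the one subtracted in the variance.
  have h0 : (Finset.univ.filter fun A : Finset (Fin K) => ¬ A.Nonempty) = {∅} := by
    ext A; simp [Finset.not_nonempty_iff_eq_empty]
  rw [h0, Finset.sum_singleton]
  simp only [Finset.card_empty, pow_zero, Finset.powerset_empty, Finset.sum_singleton, one_mul,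
    Nat.sub_zero, projSq_empty, add_sub_cancel_right]
  refine Finset.sum_congr rfl fun A hA => ?_
  rw [one_div_pow]
  congr 1
  have h1 : ∀ B ∈ A.powerset, (-1 : ℝ) ^ (A.card - B.card) * sigmaSqAB μ A B (partialMean μ Aᶜ f)
      = (-1 : ℝ) ^ (A.card - B.card) * projSq μ f B
        - (-1 : ℝ) ^ (A.card - B.card) * (∫ x, f x ∂Measure.pi μ) ^ 2 := fun B hB => by
    rw [sigmaSqAB_partialMean hf (Finset.mem_powerset.1 hB), mul_sub]
  rw [Finset.sum_congr rfl h1, Finset.sum_sub_distrib, ← Finset.sum_mul,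
    sum_powerset_neg_one_pow_card_sub (Finset.mem_filter.1 hA).2, zero_mul, sub_zero]

/-- The mean of centred samples that pairwise share no coordinate has variance `‖f‖² / N`. -/
lemma integral_mean_recombine_sq (hX : ∀ n, HasLaw (X n) (Measure.pi μ) P) (hind : iIndepFun X P)
    {f : (∀ k, S k) → ℝ} (hf : MemLp f 2 (Measure.pi μ)) (h0 : ∫ x, f x ∂Measure.pi μ = 0)
    {N : ℕ} (hN : 0 < N) (e : Fin N → Fin K → ℕ) (he : ∀ i j k, e i k = e j k → i = j) :
    ∫ ω, (1 / (N : ℝ) * ∑ j, f (fun k => X (e j k) ω k)) ^ 2 ∂P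
      = 1 / N * ∫ x, f x ^ 2 ∂Measure.pi μ := by
  have hL (j : Fin N) := memLp_recombine hX hind hf (e j)
  have hI (i j : Fin N) :
      Integrable (fun ω => f (fun k => X (e i k) ω k) * f (fun k => X (e j k) ω k)) P :=
    (hL i).integrable_mul (hL j)
  simp_rw [mul_pow]
  rw [integral_const_mul]
  simp_rw [sq (∑ j : Fin N, _), Finset.sum_mul_sum]
  rw [integral_finsetSum _ fun n _ => integrable_finsetSum _ fun n' _ => hI n n']
  have h (n : Fin N) := integral_finsetSum (Finset.univ) fun n' _ => hI n n'
  have h2 (i j : Fin N) : projSq μ f {k | e i k = e j k}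
      = if i = j then ∫ x, f x ^ 2 ∂Measure.pi μ else 0 := by
    split_ifs with hij
    · simp [hij, projSq_univ]
    · rw [Finset.filter_eq_empty_iff.2 fun k _ hk => hij (he i j k hk), projSq_empty, h0]
      simp
  simp_rw [h, integral_recombine_mul_recombine hX hind hf, h2]
  have hN' : (N : ℝ) ≠ 0 := by positivity
  simp
  field_simp

omit [∀ k, MeasurableSpace (S k)] in
/-- The product-form estimator is the average of the standard estimators built from the samples
recombined by cyclic shifts. -/
lemma productEstimator_eq_average_shift {N : ℕ} [NeZero N] (f : (∀ k, S k) → ℝ)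
    (x : ℕ → ∀ k, S k) :
    productEstimator N f x = 1 / (N : ℝ) ^ K * ∑ s : Fin K → Fin N,
      1 / (N : ℝ) * ∑ j : Fin N, f (fun k => x ((s k + j : Fin N) : ℕ) k) := by
  rw [productEstimator, ← Finset.mul_sum, Finset.sum_comm]
  have h (j : Fin N) : ∑ s : Fin K → Fin N, f (fun k => x ((s k + j : Fin N) : ℕ) k)
      = ∑ s : Fin K → Fin N, f (fun k => x (s k) k) :=
    Equiv.sum_comp (Equiv.addRight fun _ : Fin K => j) fun s => f (fun k => x (s k) k)
  simp [h, NeZero.ne N]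

/-- Cauchy–Schwarz over the `N^K` shifts: within one shift, points with different `j` share no
coordinate, so every shifted mean has the second moment of the standard estimator. -/
lemma integral_productEstimator_sq_le (hX : ∀ n, HasLaw (X n) (Measure.pi μ) P)
    (hind : iIndepFun X P) {f : (∀ k, S k) → ℝ} (hf : MemLp f 2 (Measure.pi μ))
    (h0 : ∫ x, f x ∂Measure.pi μ = 0) {N : ℕ} (hN : 0 < N) :
    ∫ ω, productEstimator N f (fun n => X n ω) ^ 2 ∂P ≤ 1 / N * ∫ x, f x ^ 2 ∂Measure.pi μ := by
  have : NeZero N := ⟨hN.ne'⟩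
  have hN' : (N : ℝ) ≠ 0 := by positivity
  let T (s : Fin K → Fin N) (ω : Ω) : ℝ :=
    1 / (N : ℝ) * ∑ j : Fin N, f (fun k => X ((s k + j : Fin N) : ℕ) ω k)
  have hT (s) : MemLp (T s) 2 P := (memLp_finsetSum _ fun j _ =>
    memLp_recombine hX hind hf fun k => ((s k + j : Fin N) : ℕ)).const_mul _
  have hTsq (s) : ∫ ω, T s ω ^ 2 ∂P = 1 / N * ∫ x, f x ^ 2 ∂Measure.pi μ :=
    integral_mean_recombine_sq hX hind hf h0 hN (fun j k => ((s k + j : Fin N) : ℕ))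
      fun i j k h => add_left_cancel (Fin.val_injective h)
  have hle (ω) : productEstimator N f (fun n => X n ω) ^ 2 ≤ 1 / (N : ℝ) ^ K * ∑ s, T s ω ^ 2 := by
    rw [productEstimator_eq_average_shift, mul_pow]
    have := sq_sum_le_card_mul_sum_sq (s := Finset.univ) (f := fun s => T s ω)
    simp only [Finset.card_univ, Fintype.card_pi, Fintype.card_fin, Finset.prod_const] at this
    push_cast at this
    calc _ ≤ (1 / (N : ℝ) ^ K) ^ 2 * ((N : ℝ) ^ K * ∑ s, T s ω ^ 2) := by gcongr
      _ = _ := by field_simp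
  calc _ ≤ ∫ ω, 1 / (N : ℝ) ^ K * ∑ s, T s ω ^ 2 ∂P :=
        integral_mono (memLp_productEstimator hX hind hf N).integrable_sq
          ((integrable_finsetSum _ fun s _ => (hT s).integrable_sq).const_mul _) hle
    _ = _ := by
        rw [integral_const_mul, integral_finsetSum _ fun s _ => (hT s).integrable_sq]
        simp_rw [hTsq]
        simp [hN']

lemma integral_standardEstimator_sq (hX : ∀ n, HasLaw (X n) (Measure.pi μ) P)
    (hind : iIndepFun X P) {f : (∀ k, S k) → ℝ} (hf : MemLp f 2 (Measure.pi μ))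
    (h0 : ∫ x, f x ∂Measure.pi μ = 0) {N : ℕ} (hN : 0 < N) :
    ∫ ω, standardEstimator N f (fun n => X n ω) ^ 2 ∂P = 1 / N * ∫ x, f x ^ 2 ∂Measure.pi μ :=
  integral_mean_recombine_sq hX hind hf h0 hN (fun j _ => (j : ℕ))
    fun _ _ _ h => Fin.val_injective h

lemma memLp_standardEstimator (hX : ∀ n, HasLaw (X n) (Measure.pi μ) P) (hind : iIndepFun X P)
    {f : (∀ k, S k) → ℝ} {p : ENNReal} (hf : MemLp f p (Measure.pi μ)) (N : ℕ) :
    MemLp (fun ω => standardEstimator N f fun n => X n ω) p P :=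
  (memLp_finsetSum Finset.univ fun (n : Fin N) _ =>
    memLp_recombine hX hind hf fun _ => (n : ℕ)).const_mul (1 / (N : ℝ))

omit [∀ k, MeasurableSpace (S k)] in
lemma productEstimator_sub_const {N : ℕ} (hN : 0 < N) (f : (∀ k, S k) → ℝ) (m : ℝ)
    (x : ℕ → ∀ k, S k) :
    productEstimator N (fun y => f y - m) x = productEstimator N f x - m := by
  have hN' : (N : ℝ) ≠ 0 := by positivity
  simp [productEstimator, mul_sub, hN']

omit [∀ k, MeasurableSpace (S k)] in
lemma standardEstimator_sub_const {N : ℕ} (hN : 0 < N) (f : (∀ k, S k) → ℝ) (m : ℝ)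
    (x : ℕ → ∀ k, S k) :
    standardEstimator N (fun y => f y - m) x = standardEstimator N f x - m := by
  have hN' : (N : ℝ) ≠ 0 := by positivity
  simp [standardEstimator, mul_sub, hN']

omit [∀ k, IsProbabilityMeasure (μ k)] [IsProbabilityMeasure P] in
lemma integral_standardEstimator (hX : ∀ n, HasLaw (X n) (Measure.pi μ) P)
    {f : (∀ k, S k) → ℝ} (hf : Integrable f (Measure.pi μ)) {N : ℕ} (hN : 0 < N) :
    ∫ ω, standardEstimator N f (fun n => X n ω) ∂P = ∫ x, f x ∂Measure.pi μ := by
  have h (n : ℕ) : Integrable (fun ω => f (X n ω)) P := by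
    have h := hX n
    rw [← h.map_eq] at hf
    exact hf.comp_aemeasurable h.aemeasurable
  have h' (n : ℕ) : ∫ ω, f (X n ω) ∂P = ∫ x, f x ∂Measure.pi μ := (hX n).integral_comp hf.1
  simp_rw [standardEstimator]
  rw [integral_const_mul, integral_finsetSum _ fun (n : Fin N) _ => h n]
  have : (N : ℝ) ≠ 0 := by positivity
  simp [h', this]

lemma variance_productEstimator_le (hX : ∀ n, HasLaw (X n) (Measure.pi μ) P)
    (hind : iIndepFun X P) {f : (∀ k, S k) → ℝ} (hf : MemLp f 2 (Measure.pi μ)) {N : ℕ}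
    (hN : 0 < N) :
    Var[fun ω => productEstimator N f (fun n => X n ω); P]
      ≤ Var[fun ω => standardEstimator N f (fun n => X n ω); P] := by
  have hi := hf.integrable one_le_two
  have hc : MemLp (fun x => f x - ∫ y, f y ∂Measure.pi μ) 2 (Measure.pi μ) :=
    hf.sub (memLp_const _)
  have h0 : ∫ x, (f x - ∫ y, f y ∂Measure.pi μ) ∂Measure.pi μ = 0 := by
    rw [integral_sub hi (integrable_const _)]; simp
  rw [variance_eq_integral (memLp_productEstimator hX hind hf N).1.aemeasurable,
    variance_eq_integral (memLp_standardEstimator hX hind hf N).1.aemeasurable,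
    integral_productEstimator hX hind hi hN, integral_standardEstimator hX hi hN]
  simp_rw [← productEstimator_sub_const hN, ← standardEstimator_sub_const hN]
  rw [integral_standardEstimator_sq hX hind hc h0 hN]
  exact integral_productEstimator_sq_le hX hind hc h0 hN

end Variance

/-! ### Projection onto sums of one-coordinate functions. -/

section MainEffects

variable {K : ℕ} {S : Fin K → Type*} [∀ k, MeasurableSpace (S k)]

/-- The sum of the projections of `f` onto the functions of a single coordinate. -/
noncomputable def mainEffects (μ : ∀ k, Measure (S k)) (f : (∀ k, S k) → ℝ) : (∀ k, S k) → ℝ :=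
  fun x => ∑ k, partialMean μ {k}ᶜ f x

variable {μ : ∀ k, Measure (S k)} [∀ k, IsProbabilityMeasure (μ k)] {f : (∀ k, S k) → ℝ}

lemma memLp_mainEffects (hf : MemLp f 2 (Measure.pi μ)) :
    MemLp (mainEffects μ f) 2 (Measure.pi μ) :=
  memLp_finsetSum _ fun _ _ => memLp_two_partialMean hf _

lemma integral_mainEffects (hf : MemLp f 2 (Measure.pi μ)) (h0 : ∫ x, f x ∂Measure.pi μ = 0) :
    ∫ x, mainEffects μ f x ∂Measure.pi μ = 0 := by
  have hi := hf.integrable one_le_two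
  simp_rw [mainEffects]
  rw [integral_finsetSum _ fun k _ => integrable_partialMean hi _]
  simp [integral_partialMean hi, h0]

/-- For `j ≠ k` the two complements cover all coordinates, leaving the full mean, which is zero.
Hence distinct main effects are orthogonal. -/
lemma partialMean_compl_singleton_comp (hf : MemLp f 2 (Measure.pi μ))
    (h0 : ∫ x, f x ∂Measure.pi μ = 0) (j k : Fin K) :
    partialMean μ {k}ᶜ (partialMean μ {j}ᶜ f) =ᵐ[Measure.pi μ]
      fun x => if j = k then partialMean μ {k}ᶜ f x else 0 := by
  filter_upwards [partialMean_partialMean (hf.integrable one_le_two) {k}ᶜ {j}ᶜ] with x hx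
  rw [hx]
  split_ifs with h
  · rw [h, Finset.union_self]
  · have : ({k}ᶜ ∪ {j}ᶜ : Finset (Fin K)) = Finset.univ := by
      ext l
      simp only [Finset.mem_union, Finset.mem_compl, Finset.mem_singleton, Finset.mem_univ,
        iff_true]
      rw [← not_and_or]
      rintro ⟨rfl, rfl⟩
      exact h rfl
    rw [this, partialMean_univ, h0]

lemma integral_mul_mainEffects (hf : MemLp f 2 (Measure.pi μ)) :
    ∫ x, f x * mainEffects μ f x ∂Measure.pi μ = ∑ k, projSq μ f {k} := by
  simp_rw [mainEffects, Finset.mul_sum]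
  have hI (k : Fin K) : Integrable (fun x => f x * partialMean μ {k}ᶜ f x) (Measure.pi μ) :=
    hf.integrable_mul (memLp_two_partialMean hf {k}ᶜ)
  rw [integral_finsetSum _ fun k _ => hI k]
  refine Finset.sum_congr rfl fun k _ => ?_
  rw [integral_mul_partialMean hf hf, projSq]
  simp_rw [sq]

lemma partialMean_mainEffects (hf : MemLp f 2 (Measure.pi μ))
    (h0 : ∫ x, f x ∂Measure.pi μ = 0) (k : Fin K) :
    partialMean μ {k}ᶜ (mainEffects μ f) =ᵐ[Measure.pi μ] partialMean μ {k}ᶜ f := by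
  have hi := hf.integrable one_le_two
  filter_upwards [partialMean_sum Finset.univ (fun j => integrable_partialMean hi {j}ᶜ) {k}ᶜ,
    ae_all_iff.2 fun j => partialMean_compl_singleton_comp hf h0 j k] with x hx hc
  change partialMean μ {k}ᶜ (fun x => ∑ j, partialMean μ {j}ᶜ f x) x = _
  rw [hx, Finset.sum_congr rfl fun j _ => hc j]
  simp

lemma integral_mainEffects_sq (hf : MemLp f 2 (Measure.pi μ))
    (h0 : ∫ x, f x ∂Measure.pi μ = 0) :
    ∫ x, mainEffects μ f x ^ 2 ∂Measure.pi μ = ∑ k, projSq μ f {k} := by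
  have hH := memLp_mainEffects hf
  have h (x) : mainEffects μ f x ^ 2 = ∑ k, mainEffects μ f x * partialMean μ {k}ᶜ f x := by
    rw [← Finset.mul_sum, sq]; rfl
  have hI (k : Fin K) :
      Integrable (fun x => mainEffects μ f x * partialMean μ {k}ᶜ f x) (Measure.pi μ) :=
    hH.integrable_mul (memLp_two_partialMean hf {k}ᶜ)
  simp_rw [h]
  rw [integral_finsetSum _ fun k _ => hI k]
  refine Finset.sum_congr rfl fun k _ => ?_
  rw [integral_mul_partialMean hH hf, projSq]
  refine integral_congr_ae ?_
  filter_upwards [partialMean_mainEffects hf h0 k] with x hx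
  rw [hx, sq]

/-- Bessel's inequality: the inner product of `f` with its main effects equals their squared norm,
so expanding the squared norm of the residual leaves the difference of the two sides. -/
lemma sum_projSq_singleton_le (hf : MemLp f 2 (Measure.pi μ))
    (h0 : ∫ x, f x ∂Measure.pi μ = 0) :
    ∑ k, projSq μ f {k} ≤ ∫ x, f x ^ 2 ∂Measure.pi μ := by
  have hH := memLp_mainEffects hf
  have h : 0 ≤ ∫ x, (f x - mainEffects μ f x) ^ 2 ∂Measure.pi μ :=
    integral_nonneg fun _ => sq_nonneg _
  have hmul : Integrable (fun x => 2 * (f x * mainEffects μ f x)) (Measure.pi μ) :=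
    (hf.integrable_mul hH).const_mul 2
  have he (x) : (f x - mainEffects μ f x) ^ 2
      = f x ^ 2 - 2 * (f x * mainEffects μ f x) + mainEffects μ f x ^ 2 := by ring
  have hsub : Integrable (fun x => f x ^ 2 - 2 * (f x * mainEffects μ f x)) (Measure.pi μ) :=
    hf.integrable_sq.sub hmul
  simp_rw [he] at h
  rw [integral_add hsub hH.integrable_sq,
    integral_sub hf.integrable_sq hmul, integral_const_mul, integral_mul_mainEffects hf,
    integral_mainEffects_sq hf h0] at h
  linarith

/-- The residual `f - mainEffects μ f` is orthogonal to the functions of a single coordinate. -/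
lemma projSq_residual_eq_zero (hf : MemLp f 2 (Measure.pi μ))
    (h0 : ∫ x, f x ∂Measure.pi μ = 0) {B : Finset (Fin K)} (hB : B.card < 2) :
    projSq μ (fun x => f x - mainEffects μ f x) B = 0 := by
  have hi := hf.integrable one_le_two
  have hH := (memLp_mainEffects hf).integrable one_le_two
  obtain h | h : B.card = 0 ∨ B.card = 1 := by omega
  · rw [Finset.card_eq_zero.1 h, projSq_empty, integral_sub hi hH, h0,
      integral_mainEffects hf h0]
    simp
  · obtain ⟨k, rfl⟩ := Finset.card_eq_one.1 h
    rw [projSq, ← integral_zero (∀ k, S k) ℝ]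
    refine integral_congr_ae ?_
    filter_upwards [partialMean_sub hi hH {k}ᶜ, partialMean_mainEffects hf h0 k] with x h1 h2
    rw [h1, h2]
    simp

omit [∀ k, MeasurableSpace (S k)] in
lemma productEstimator_sum {ι : Type*} (s : Finset ι) (N : ℕ) (g : ι → (∀ k, S k) → ℝ)
    (x : ℕ → ∀ k, S k) :
    productEstimator N (fun y => ∑ i ∈ s, g i y) x = ∑ i ∈ s, productEstimator N (g i) x := by
  simp_rw [productEstimator]
  rw [Finset.sum_comm, Finset.mul_sum]

omit [∀ k, MeasurableSpace (S k)] in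
lemma standardEstimator_sum {ι : Type*} (s : Finset ι) (N : ℕ) (g : ι → (∀ k, S k) → ℝ)
    (x : ℕ → ∀ k, S k) :
    standardEstimator N (fun y => ∑ i ∈ s, g i y) x = ∑ i ∈ s, standardEstimator N (g i) x := by
  simp_rw [standardEstimator]
  rw [Finset.sum_comm, Finset.mul_sum]

omit [∀ k, MeasurableSpace (S k)] in
/-- On functions of a single coordinate the two estimators agree. -/
lemma productEstimator_eq_standardEstimator {N : ℕ} (hN : 0 < N) {g : (∀ k, S k) → ℝ} (k : Fin K)
    (hg : ∀ x y : ∀ k, S k, x k = y k → g x = g y) (x : ℕ → ∀ k, S k) :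
    productEstimator N g x = standardEstimator N g x := by
  have : NeZero N := ⟨hN.ne'⟩
  rw [productEstimator_eq_average_shift, standardEstimator]
  have h (s : Fin K → Fin N) : ∑ j : Fin N, g (fun l => x ((s l + j : Fin N) : ℕ) l)
      = ∑ j : Fin N, g (x j) := by
    -- Only the shift `s k` of the coordinate seen by `g` matters, and it merely permutes the
    -- samples.
    rw [← Equiv.sum_comp (Equiv.addLeft (s k)) fun j : Fin N => g (x j)]
    exact Finset.sum_congr rfl fun j _ => hg _ _ rfl
  simp [h, hN.ne']

lemma productEstimator_mainEffects {N : ℕ} (hN : 0 < N) (x : ℕ → ∀ k, S k) :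
    productEstimator N (mainEffects μ f) x = standardEstimator N (mainEffects μ f) x := by
  unfold mainEffects
  rw [productEstimator_sum, standardEstimator_sum]
  refine Finset.sum_congr rfl fun k _ => productEstimator_eq_standardEstimator hN k ?_ x
  intro x y hxy
  exact partialMean_congr_point μ _ _ fun l hl => by
    obtain rfl : l = k := by simpa using hl
    exact hxy

lemma productEstimator_eq_mainEffects_add_residual {N : ℕ} (hN : 0 < N) (x : ℕ → ∀ k, S k) :
    productEstimator N f x = standardEstimator N (mainEffects μ f) x
      + productEstimator N (fun y => f y - mainEffects μ f y) x := by
  rw [← productEstimator_mainEffects hN]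
  simp only [productEstimator, Finset.sum_sub_distrib]
  ring

end MainEffects

/-! ### Strong consistency and asymptotic normality. -/

section Limits

variable {K : ℕ} {S : Fin K → Type*} [∀ k, MeasurableSpace (S k)]
  {μ : ∀ k, Measure (S k)} [∀ k, IsProbabilityMeasure (μ k)]
  {Ω : Type*} [MeasurableSpace Ω] {P : Measure Ω} [IsProbabilityMeasure P]
  {X : ℕ → Ω → ∀ k, S k} {f : (∀ k, S k) → ℝ}

/-- In the second-moment formula the terms with `|B| < 2` vanish and the others have weight at most
`N⁻²`. -/
lemma exists_integral_productEstimator_residual_sq_le (hX : ∀ n, HasLaw (X n) (Measure.pi μ) P)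
    (hind : iIndepFun X P) (hf : MemLp f 2 (Measure.pi μ)) (h0 : ∫ x, f x ∂Measure.pi μ = 0) :
    ∃ C : ℝ, 0 ≤ C ∧ ∀ N : ℕ, 0 < N →
      ∫ ω, productEstimator N (fun y => f y - mainEffects μ f y) (fun n => X n ω) ^ 2 ∂P
        ≤ C * (1 / (N : ℝ) ^ 2) := by
  set r : (∀ k, S k) → ℝ := fun y => f y - mainEffects μ f y with hr
  have hrL : MemLp r 2 (Measure.pi μ) := hf.sub (memLp_mainEffects hf)
  have hG (B) : 0 ≤ projSq μ r B := integral_nonneg fun _ => sq_nonneg _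
  refine ⟨∑ B, projSq μ r B, Finset.sum_nonneg fun B _ => hG B, fun N hN => ?_⟩
  rw [integral_productEstimator_sq hX hind hrL hN, Finset.sum_mul]
  refine Finset.sum_le_sum fun B _ => ?_
  by_cases hB : B.card < 2
  · rw [projSq_residual_eq_zero hf h0 hB]; simp
  · have hN1 : (1 : ℝ) ≤ N := by exact_mod_cast hN
    have h1 : 1 / (N : ℝ) ≤ 1 := by rw [div_le_one (by positivity)]; exact hN1
    have h2 : 0 ≤ 1 / (N : ℝ) := by positivity
    have h3 : (1 / (N : ℝ)) ^ B.card ≤ (1 / (N : ℝ)) ^ 2 :=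
      pow_le_pow_of_le_one h2 h1 (by omega)
    have h4 : (1 - 1 / (N : ℝ)) ^ Bᶜ.card ≤ 1 := pow_le_one₀ (by linarith) (by linarith)
    rw [mul_comm (projSq μ r B), ← one_div_pow]
    refine mul_le_mul_of_nonneg_right ?_ (hG B)
    calc _ ≤ (1 / (N : ℝ)) ^ 2 * 1 := by gcongr
      _ = _ := mul_one _

omit [IsProbabilityMeasure P] in
/-- Random variables with summable second moments tend to zero almost surely. -/
lemma ae_tendsto_zero_of_integral_sq_le {T : ℕ → Ω → ℝ} (hT : ∀ n, MemLp (T n) 2 P)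
    {b : ℕ → ℝ} (hb : Summable b) (h : ∀ n, ∫ ω, T n ω ^ 2 ∂P ≤ b n) :
    ∀ᵐ ω ∂P, Tendsto (fun n => T n ω) atTop (𝓝 0) := by
  have hm (n) : AEMeasurable (fun ω => ENNReal.ofReal (T n ω ^ 2)) P :=
    (hT n).integrable_sq.1.aemeasurable.ennreal_ofReal
  have hb0 (n) : 0 ≤ b n := (integral_nonneg fun _ => sq_nonneg _).trans (h n)
  -- By Tonelli the sum of squares has finite expectation, so it converges almost surely and its
  -- terms tend to zero.
  have hfin : ∫⁻ ω, ∑' n, ENNReal.ofReal (T n ω ^ 2) ∂P ≠ ⊤ := by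
    rw [lintegral_tsum hm]
    refine ne_top_of_le_ne_top (b := ∑' n, ENNReal.ofReal (b n)) ?_ (ENNReal.tsum_le_tsum fun n => ?_)
    · rw [← ENNReal.ofReal_tsum_of_nonneg hb0 hb]
      exact ENNReal.ofReal_ne_top
    · rw [← ofReal_integral_eq_lintegral_ofReal (hT n).integrable_sq
        (ae_of_all _ fun _ => sq_nonneg _)]
      exact ENNReal.ofReal_le_ofReal (h n)
  filter_upwards [ae_lt_top' (AEMeasurable.tsum hm) hfin] with ω hω
  have h1 := (ENNReal.tendsto_toReal ENNReal.zero_ne_top).comp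
    (ENNReal.tendsto_atTop_zero_of_tsum_ne_top hω.ne)
  simp only [Function.comp_def, ENNReal.toReal_ofReal (sq_nonneg _), ENNReal.toReal_zero] at h1
  have h2 := h1.sqrt
  simp only [Real.sqrt_sq_eq_abs, Real.sqrt_zero] at h2
  exact (tendsto_zero_iff_abs_tendsto_zero _).2 h2

omit [∀ k, IsProbabilityMeasure (μ k)] [IsProbabilityMeasure P] in
lemma identDistrib_comp (hX : ∀ n, HasLaw (X n) (Measure.pi μ) P)
    (hf : AEStronglyMeasurable f (Measure.pi μ)) (n : ℕ) :
    IdentDistrib (fun ω => f (X n ω)) (fun ω => f (X 0 ω)) P P := by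
  have h : IdentDistrib (X n) (X 0) P P :=
    ⟨(hX n).aemeasurable, (hX 0).aemeasurable, (hX n).map_eq.trans (hX 0).map_eq.symm⟩
  exact h.comp_of_aemeasurable (by rw [(hX n).map_eq]; exact hf.aemeasurable)

omit [∀ k, IsProbabilityMeasure (μ k)] [IsProbabilityMeasure P] in
lemma iIndepFun_comp (hX : ∀ n, HasLaw (X n) (Measure.pi μ) P) (hind : iIndepFun X P)
    (hf : AEStronglyMeasurable f (Measure.pi μ)) :
    iIndepFun (fun n ω => f (X n ω)) P :=
  hind.comp₀ (fun _ => f) (fun n => (hX n).aemeasurable)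
    fun n => by rw [(hX n).map_eq]; exact hf.aemeasurable

omit [∀ k, IsProbabilityMeasure (μ k)] [IsProbabilityMeasure P] in
lemma tendsto_standardEstimator (hX : ∀ n, HasLaw (X n) (Measure.pi μ) P) (hind : iIndepFun X P)
    (hf : Integrable f (Measure.pi μ)) :
    ∀ᵐ ω ∂P, Tendsto (fun N => standardEstimator N f (fun n => X n ω)) atTop
      (𝓝 (∫ x, f x ∂Measure.pi μ)) := by
  have hint : Integrable (fun ω => f (X 0 ω)) P := by
    rw [← (hX 0).map_eq] at hf
    exact hf.comp_aemeasurable (hX 0).aemeasurable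
  have h := strong_law_ae_real (fun n ω => f (X n ω)) hint
    (fun i j hij => (iIndepFun_comp hX hind hf.1).indepFun hij) (identDistrib_comp hX hf.1)
  have h0 : ∫ ω, f (X 0 ω) ∂P = ∫ x, f x ∂Measure.pi μ := (hX 0).integral_comp hf.1
  filter_upwards [h] with ω hω
  rw [h0] at hω
  refine hω.congr fun N => ?_
  rw [standardEstimator, Fin.sum_univ_eq_sum_range fun n => f (X n ω)]
  ring

lemma tendsto_productEstimator (hX : ∀ n, HasLaw (X n) (Measure.pi μ) P) (hind : iIndepFun X P)
    (hf : MemLp f 2 (Measure.pi μ)) :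
    ∀ᵐ ω ∂P, Tendsto (fun N => productEstimator N f (fun n => X n ω)) atTop
      (𝓝 (∫ x, f x ∂Measure.pi μ)) := by
  set m := ∫ x, f x ∂Measure.pi μ with hm
  set g : (∀ k, S k) → ℝ := fun x => f x - m with hg
  have hgL : MemLp g 2 (Measure.pi μ) := hf.sub (memLp_const _)
  have h0 : ∫ x, g x ∂Measure.pi μ = 0 := by
    rw [hg, integral_sub (hf.integrable one_le_two) (integrable_const _)]; simp [hm]
  obtain ⟨C, -, hC⟩ := exists_integral_productEstimator_residual_sq_le hX hind hgL h0
  have hrL := hgL.sub (memLp_mainEffects hgL)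
  -- The moment bound needs `N > 0`, hence the shift to `n + 1`.
  have hr := ae_tendsto_zero_of_integral_sq_le
    (fun n => memLp_productEstimator hX hind hrL (n + 1))
    (((summable_nat_add_iff 1).2 (Real.summable_one_div_nat_pow.2 one_lt_two)).mul_left C)
    fun n => hC (n + 1) n.succ_pos
  filter_upwards [hr, tendsto_standardEstimator hX hind
    ((memLp_mainEffects hgL).integrable one_le_two)] with ω h1 h2
  rw [integral_mainEffects hgL h0] at h2
  have h3 := ((h2.add ((tendsto_add_atTop_iff_nat (f := fun N => productEstimator N
    (g - mainEffects μ g) fun n => X n ω) 1).1 h1)).add_const m)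
  rw [add_zero, zero_add] at h3
  refine h3.congr' ?_
  filter_upwards [eventually_gt_atTop 0] with N hN
  have h4 := productEstimator_sub_const hN f m fun n => X n ω
  rw [productEstimator_eq_mainEffects_add_residual (μ := μ) hN] at h4
  exact eq_sub_iff_add_eq.1 h4

omit [∀ k, IsProbabilityMeasure (μ k)] in
lemma asymptoticallyNormal_standardEstimator (hX : ∀ n, HasLaw (X n) (Measure.pi μ) P)
    (hind : iIndepFun X P) (hf : MemLp f 2 (Measure.pi μ)) :
    AsymptoticallyNormal P (fun N ω => standardEstimator N f (fun n => X n ω))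
      (∫ x, f x ∂Measure.pi μ) (sigmaSq μ f) := by
  refine ⟨integral_nonneg fun _ => sq_nonneg _, ?_⟩
  have h0 : ∫ ω, f (X 0 ω) ∂P = ∫ x, f x ∂Measure.pi μ := (hX 0).integral_comp hf.1
  have hL : MemLp (fun ω => f (X 0 ω)) 2 P := by
    rw [← (hX 0).map_eq] at hf
    exact hf.comp_of_map (hX 0).aemeasurable
  have hv : Var[fun ω => f (X 0 ω); P] = sigmaSq μ f := by
    rw [variance_eq_integral hL.1.aemeasurable, h0]
    exact (hX 0).integral_comp (f := fun x => (f x - ∫ x, f x ∂Measure.pi μ) ^ 2)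
      ((hf.1.sub aestronglyMeasurable_const).pow 2)
  have h := tendstoInDistribution_inv_sqrt_mul_sum_sub (X := fun n ω => f (X n ω))
    (HasLaw.id (μ := gaussianReal 0 (Var[fun ω => f (X 0 ω); P]).toNNReal)) hL
    (iIndepFun_comp hX hind hf.1) (identDistrib_comp hX hf.1)
  rw [hv, h0] at h
  refine h.congr (fun N => ae_of_all _ fun ω => ?_) EventuallyEq.rfl
  dsimp only
  rw [standardEstimator, Fin.sum_univ_eq_sum_range fun n => f (X n ω)]
  rcases N.eq_zero_or_pos with rfl | hN
  · simp
  · have hN' : (0 : ℝ) < N := by positivity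
    have : √(N : ℝ) ≠ 0 := by positivity
    have h2 : (N : ℝ) = √N ^ 2 := (Real.sq_sqrt hN'.le).symm
    field_simp
    rw [← h2]

omit [IsProbabilityMeasure P] in
lemma tendstoInMeasure_zero_of_integral_sq_le {T : ℕ → Ω → ℝ} (hT : ∀ n, MemLp (T n) 2 P)
    {b : ℕ → ℝ} (hb : Tendsto b atTop (𝓝 0)) (h : ∀ᶠ n in atTop, ∫ ω, T n ω ^ 2 ∂P ≤ b n) :
    TendstoInMeasure P T atTop 0 := by
  refine tendstoInMeasure_of_tendsto_eLpNorm two_ne_zero (fun n => (hT n).1)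
    aestronglyMeasurable_zero ?_
  have h0 : Tendsto (fun n => ∫ ω, T n ω ^ 2 ∂P) atTop (𝓝 0) :=
    tendsto_of_tendsto_of_tendsto_of_le_of_le' tendsto_const_nhds hb
      (Eventually.of_forall fun n => integral_nonneg fun _ => sq_nonneg _) h
  have h1 := ENNReal.tendsto_ofReal h0.sqrt
  simp only [Real.sqrt_zero, ENNReal.ofReal_zero] at h1
  refine h1.congr fun n => ?_
  rw [sub_zero, (hT n).eLpNorm_eq_integral_rpow_norm two_ne_zero ENNReal.ofNat_ne_top]
  simp [Real.sqrt_eq_rpow]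

lemma sigmaSqProd_eq (hf : MemLp f 2 (Measure.pi μ)) :
    sigmaSqProd μ f = ∑ k, projSq μ (fun x => f x - ∫ y, f y ∂Measure.pi μ) {k} := by
  refine Finset.sum_congr rfl fun k _ => integral_congr_ae ?_
  filter_upwards [partialMean_sub (hf.integrable one_le_two)
    (integrable_const (∫ y, f y ∂Measure.pi μ)) {k}ᶜ] with x hx
  rw [hx, partialMean_const]

lemma sigmaSqProd_le_sigmaSq (hf : MemLp f 2 (Measure.pi μ)) :
    sigmaSqProd μ f ≤ sigmaSq μ f := by
  rw [sigmaSqProd_eq hf]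
  refine sum_projSq_singleton_le (hf.sub (memLp_const _)) ?_
  rw [integral_sub (hf.integrable one_le_two) (integrable_const _)]
  simp

/-- Slutsky's argument: the main effects satisfy the central limit theorem, and the scaled residual
tends to zero in measure. -/
lemma asymptoticallyNormal_productEstimator (hX : ∀ n, HasLaw (X n) (Measure.pi μ) P)
    (hind : iIndepFun X P) (hf : MemLp f 2 (Measure.pi μ)) :
    AsymptoticallyNormal P (fun N ω => productEstimator N f (fun n => X n ω))
      (∫ x, f x ∂Measure.pi μ) (sigmaSqProd μ f) := by
  set m := ∫ x, f x ∂Measure.pi μ with hm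
  set g : (∀ k, S k) → ℝ := fun x => f x - m with hg
  have hgL : MemLp g 2 (Measure.pi μ) := hf.sub (memLp_const _)
  have h0 : ∫ x, g x ∂Measure.pi μ = 0 := by
    rw [hg, integral_sub (hf.integrable one_le_two) (integrable_const _)]; simp [hm]
  obtain ⟨C, -, hC⟩ := exists_integral_productEstimator_residual_sq_le hX hind hgL h0
  have hrL : MemLp (fun y => g y - mainEffects μ g y) 2 (Measure.pi μ) :=
    hgL.sub (memLp_mainEffects hgL)
  have hv : sigmaSq μ (mainEffects μ g) = sigmaSqProd μ f := by
    rw [sigmaSqProd_eq hf, ← integral_mainEffects_sq hgL h0, sigmaSq,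
      integral_mainEffects hgL h0]
    simp
  obtain ⟨hnonneg, hN⟩ := asymptoticallyNormal_standardEstimator hX hind (memLp_mainEffects hgL)
  rw [hv] at hnonneg hN
  refine ⟨hnonneg, tendstoInDistribution_of_tendstoInMeasure_sub _ _ hN ?_ fun N =>
    (((memLp_productEstimator hX hind hf N).1.aemeasurable.sub_const m).const_mul _)⟩
  rw [integral_mainEffects hgL h0]
  have hT (N : ℕ) : MemLp (fun ω => √(N : ℝ) *
      productEstimator N (fun y => g y - mainEffects μ g y) fun n => X n ω) 2 P :=
    (memLp_productEstimator hX hind hrL N).const_mul _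
  have hlim : Tendsto (fun N : ℕ => C * (1 / (N : ℝ))) atTop (𝓝 0) := by
    simpa using tendsto_one_div_atTop_nhds_zero_nat.const_mul C
  have hmeas := tendstoInMeasure_zero_of_integral_sq_le hT hlim (by
    filter_upwards [eventually_gt_atTop 0] with N hN
    have hN' : (0 : ℝ) < N := by positivity
    simp_rw [mul_pow, Real.sq_sqrt hN'.le]
    rw [integral_const_mul]
    -- Squaring `√N` costs one power of `N`; the `N⁻²` decay still leaves `C / N`.
    calc _ ≤ (N : ℝ) * (C * (1 / (N : ℝ) ^ 2)) := by gcongr; exact hC N hN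
      _ = _ := by field_simp)
  convert! hmeas using 1
  ext N ω
  simp only [Pi.sub_apply]
  rcases N.eq_zero_or_pos with rfl | hN
  · simp
  · rw [← productEstimator_sub_const hN f m,
      productEstimator_eq_mainEffects_add_residual (μ := μ) (f := fun y => f y - m) hN]
    ring

end Limits

/-! ### Importance sampling by change of measure. -/

theorem corollary2 {K : ℕ} {S : Fin K → Type*} [∀ k, MeasurableSpace (S k)]
    -- the product-form proposal `μ₁ × ⋯ × μ_K`
    (μ : ∀ k, Measure (S k)) [∀ k, IsProbabilityMeasure (μ k)]
    -- the finite target and (a version of) its density with respect to the proposal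
    (γ : Measure (∀ k, S k)) [IsFiniteMeasure γ] (hγ : γ ≪ Measure.pi μ)
    (w : (∀ k, S k) → ℝ) (hw : w =ᵐ[Measure.pi μ] fun x => (γ.rnDeriv (Measure.pi μ) x).toReal)
    -- i.i.d. samples from the proposal
    {Ω : Type*} [MeasurableSpace Ω] (P : Measure Ω) [IsProbabilityMeasure P]
    (X : ℕ → Ω → ∀ k, S k) (hX : ∀ n, HasLaw (X n) (Measure.pi μ) P) (hind : iIndepFun X P)
    -- the test function
    (φ : (∀ k, S k) → ℝ) (hφ : Integrable φ γ) :
    -- unbiasedness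
    (∀ N : ℕ, 0 < N →
      Integrable (fun ω => productIS N w φ (fun n => X n ω)) P ∧
      ∫ ω, productIS N w φ (fun n => X n ω) ∂P = ∫ x, φ x ∂γ) ∧
    (MemLp (fun x => w x * φ x) 2 (Measure.pi μ) →
      -- strong consistency
      (∀ᵐ ω ∂P, Tendsto (fun N => productIS N w φ (fun n => X n ω)) atTop (𝓝 (∫ x, φ x ∂γ))) ∧
      -- asymptotic normality, with the asymptotic variances of both estimators
      AsymptoticallyNormal P (fun N ω => productIS N w φ (fun n => X n ω)) (∫ x, φ x ∂γ)
        (sigmaSqProd μ (fun x => w x * φ x)) ∧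
      AsymptoticallyNormal P (fun N ω => standardIS N w φ (fun n => X n ω)) (∫ x, φ x ∂γ)
        (sigmaSq μ (fun x => w x * φ x)) ∧
      -- the variances are well defined
      (∀ A : Finset (Fin K),
        MemLp (partialMean μ Aᶜ (fun x => w x * φ x)) 2 (Measure.pi μ)) ∧
      (∀ N : ℕ, 0 < N →
        MemLp (fun ω => productIS N w φ (fun n => X n ω)) 2 P ∧
        MemLp (fun ω => standardIS N w φ (fun n => X n ω)) 2 P) ∧
      -- the finite-sample variance and its bound
      (∀ N : ℕ, 0 < N →
        Var[fun ω => productIS N w φ (fun n => X n ω); P]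
          = productVarianceFormula μ N (fun x => w x * φ x) ∧
        Var[fun ω => productIS N w φ (fun n => X n ω); P]
          ≤ Var[fun ω => standardIS N w φ (fun n => X n ω); P]) ∧
      -- the bound on the asymptotic variance
      sigmaSqProd μ (fun x => w x * φ x) ≤ sigmaSq μ (fun x => w x * φ x)) := by
  have hae : (fun x => w x * φ x)
      =ᵐ[Measure.pi μ] fun x => (γ.rnDeriv (Measure.pi μ) x).toReal * φ x := by
    filter_upwards [hw] with x hx
    rw [hx]
  have hint : Integrable (fun x => w x * φ x) (Measure.pi μ) :=
    ((integrable_rnDeriv_smul_iff hγ).2 hφ).congr hae.symm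
  have hmean : ∫ x, φ x ∂γ = ∫ x, w x * φ x ∂Measure.pi μ := by
    rw [integral_congr_ae hae]
    exact (integral_rnDeriv_smul hγ).symm
  rw [hmean]
  refine ⟨fun N hN => ⟨memLp_one_iff_integrable.1 (memLp_productEstimator hX hind
    (memLp_one_iff_integrable.2 hint) N), integral_productEstimator hX hind hint hN⟩,
    fun hf => ⟨tendsto_productEstimator hX hind hf, asymptoticallyNormal_productEstimator hX hind hf,
      asymptoticallyNormal_standardEstimator hX hind hf, fun A => memLp_two_partialMean hf Aᶜ,
      fun N _ => ⟨memLp_productEstimator hX hind hf N, memLp_standardEstimator hX hind hf N⟩,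
      fun N hN => ⟨variance_productEstimator hX hind hf hN,
        variance_productEstimator_le hX hind hf hN⟩, sigmaSqProd_le_sigmaSq hf⟩⟩
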